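/- Let $d \ge 0$ be an integer and let $R$ be a commutative Noetherian ring. A $\mathbb{Z}/d\mathbb{Z}$-graded differential $R$-module is an $R$-module $D=\bigoplus_{j\in\mathbb{Z}/d\mathbb{Z}}D_j$ with an $R$-linear endomorphism $d^D$ such that $(d^D)^2=0$ and $d^D(D_j)\subseteq D_{j-1}$ (for $d=0$ the grading is by $\mathbb{Z}$); its homology is $H_j(D)=\ker(d^D|_{D_j})/d^D(D_{j+1})$. A morphism is a degree-$0$ $R$-linear map commuting with the differentials, and it is a quasi-isomorphism if it induces isomorphisms on all $H_j$. A $\mathbb{Z}/d\mathbb{Z}$-graded flag is such a $D$ together with a filtration by submodules $0=D^{-1}_j\subseteq D^0_j\subseteq D^1_j\subseteq\cdots$ of each $D_j$ with $\bigcup_i D^i_j=D_j$ and $d^D(D^i_j)\subseteq D^{i-1}_{j-1}$ for all $i\ge 0$ and $j$; put $D^i_j=0$ for $i<0$. It is a projective flag if all the quotients $D^i_j/D^{i-1}_j$ are projective. A projective flag resolution of $D$ is a projective flag $F$ together with a quasi-isomorphism $F\to D$ (the augmentation map), which is called flag-preserving if it maps $F^i_j$ into $D^i_j$ for all $i,j$.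 The spectral sequence of the filtration of $D$ has, in filtration degree $p\in\mathbb{Z}$ and total degree $n\in\mathbb{Z}/d\mathbb{Z}$, the terms $$E^s_{p,n}=\frac{Z^s_{p,n}}{\bigl(D^{p-1}_n+d^D(D^{p+s-1}_{n+1})\bigr)\cap Z^s_{p,n}},\qquad Z^s_{p,n}=\{x\in D^p_n : d^D(x)\in D^{p-s}_{n-1}\},$$ with differentials $E^s_{p,n}\to E^s_{p-s,n-1}$ induced by $d^D$. It degenerates on the page $E^r$ if these differentials vanish for all $s\ge r$. Theorem. Let $D$ be a $\mathbb{Z}/d\mathbb{Z}$-graded flag of $R$-modules such that every $H_j(D)$ is a finitely generated $R$-module, and assume that the spectral sequence of its filtration degenerates on the page $E^r$ for some $r\ge 2$. Then there is a projective flag resolution of $D$ whose augmentation map $\widetilde F\to D$ is flag-preserving. -/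

import Mathlib

universe u v w

/-- A `ℤ/d`-graded differential `R`-module: an `R`-module with a direct sum decomposition indexed by
`ℤ/d` and a square-zero endomorphism of degree `-1`.  Here `d` is any natural number; for `d = 0`
the index group is `ℤ` (these are the chain complexes), for `d = 1` there is no grading. -/
structure GrDiffMod (R : Type u) [CommRing R] (d : ℕ) where
  carrier : Type v
  [addCommGroup : AddCommGroup carrier]
  [module : Module R carrier]
  grade : ZMod d → Submodule R carrier
  isInternal : DirectSum.IsInternal grade
  diff : carrier →ₗ[R] carrier
  diff_diff : ∀ x, diff (diff x) = 0
  diff_grade : ∀ (j : ZMod d) (x : carrier), x ∈ grade j → diff x ∈ grade (j - 1)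

attribute [instance] GrDiffMod.addCommGroup GrDiffMod.module

namespace GrDiffMod

variable {R : Type u} [CommRing R] {d : ℕ}

/-- The cycles `Z_j(D) = ker (D_j → D_{j-1})`. -/
def cycles (D : GrDiffMod.{u, v} R d) (j : ZMod d) : Submodule R D.carrier :=
  D.grade j ⊓ LinearMap.ker D.diff

/-- The boundaries `B_j(D) = im (D_{j+1} → D_j)`. -/
def boundaries (D : GrDiffMod.{u, v} R d) (j : ZMod d) : Submodule R D.carrier :=
  (D.grade (j + 1)).map D.diff

/-- The homology `H_j(D) = Z_j(D) / B_j(D)`. -/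
abbrev homology (D : GrDiffMod.{u, v} R d) (j : ZMod d) : Type v :=
  D.cycles j ⧸ (D.boundaries j).submoduleOf (D.cycles j)

/-- A morphism of `ℤ/d`-graded differential modules: an `R`-linear map of degree `0` that commutes
with the differentials. -/
structure Hom (D : GrDiffMod.{u, v} R d) (E : GrDiffMod.{u, w} R d) where
  toLin : D.carrier →ₗ[R] E.carrier
  map_grade : ∀ (j : ZMod d) (x : D.carrier), x ∈ D.grade j → toLin x ∈ E.grade j
  comm : ∀ x, toLin (D.diff x) = E.diff (toLin x)

namespace Hom

variable {D : GrDiffMod.{u, v} R d} {E : GrDiffMod.{u, w} R d}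

theorem map_cycles (φ : Hom D E) (j : ZMod d) :
    ∀ x ∈ D.cycles j, φ.toLin x ∈ E.cycles j := by
  rintro x ⟨hx, hd⟩
  refine ⟨φ.map_grade j x hx, ?_⟩
  have hd' : D.diff x = 0 := hd
  change E.diff (φ.toLin x) = 0
  rw [← φ.comm, hd', map_zero]

theorem map_boundaries (φ : Hom D E) (j : ZMod d) :
    ∀ x ∈ D.boundaries j, φ.toLin x ∈ E.boundaries j := by
  rintro x ⟨y, hy, rfl⟩
  exact ⟨φ.toLin y, φ.map_grade _ y hy, (φ.comm y).symm⟩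

/-- The map `H_j(D) → H_j(E)` induced by a morphism `D → E`. -/
def homologyMap (φ : Hom D E) (j : ZMod d) : D.homology j →ₗ[R] E.homology j :=
  Submodule.mapQ _ _ (φ.toLin.restrict (φ.map_cycles j))
    (fun x hx => φ.map_boundaries j x.1 hx)

/-- A quasi-isomorphism is a morphism that induces an isomorphism on homology. -/
def IsQuasiIso (φ : Hom D E) : Prop :=
  ∀ j : ZMod d, Function.Bijective (φ.homologyMap j)

end Hom

end GrDiffMod

/-- A `ℤ/d`-graded flag of `R`-modules: a `ℤ/d`-graded differential module `D` with an exhaustive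
graded filtration `0 = D^{-1} ⊆ D^0 ⊆ D^1 ⊆ ⋯`, where `fil i j` is `D^i_j`, such that the
differential maps `D^i_j` into `D^{i-1}_{j-1}`.  The filtration is indexed by `ℤ`, with the
value `0` at every negative index. -/
structure GrFlag (R : Type u) [CommRing R] (d : ℕ) extends GrDiffMod.{u, v} R d where
  fil : ℤ → ZMod d → Submodule R carrier
  fil_le_grade : ∀ i j, fil i j ≤ grade j
  fil_mono : ∀ (i i' : ℤ) (j : ZMod d), i ≤ i' → fil i j ≤ fil i' j
  fil_neg : ∀ (i : ℤ) (j : ZMod d), i < 0 → fil i j = ⊥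
  fil_exhaustive : ∀ (j : ZMod d) (x : carrier), x ∈ grade j → ∃ i, x ∈ fil i j
  diff_fil : ∀ (i : ℤ) (j : ZMod d) (x : carrier), x ∈ fil i j → diff x ∈ fil (i - 1) (j - 1)

namespace GrFlag

variable {R : Type u} [CommRing R] {d : ℕ}

/-- A projective flag: every graded piece `D^i_j / D^{i-1}_j` of the filtration is a projective
`R`-module (so that the filtration splits and the module `D` itself is projective). -/
def IsProjective (F : GrFlag.{u, v} R d) : Prop :=
  ∀ (i : ℤ) (j : ZMod d),
    Module.Projective R (F.fil i j ⧸ (F.fil (i - 1) j).submoduleOf (F.fil i j))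

/-- A morphism of the underlying differential modules is flag-preserving if it maps `F^i_j` into
`D^i_j`. -/
def IsFlagPreserving {F : GrFlag.{u, v} R d} {D : GrFlag.{u, w} R d}
    (φ : GrDiffMod.Hom F.toGrDiffMod D.toGrDiffMod) : Prop :=
  ∀ (i : ℤ) (j : ZMod d) (x : F.carrier), x ∈ F.fil i j → φ.toLin x ∈ D.fil i j

/-! The spectral sequence of the filtration.  Its terms are indexed by the filtration degree `p` and
the total degree `n` in `ℤ/d`, so the term `E^r_{p,q}` in the usual indexing has `n = p + q`. -/

/-- `Z^r_{p,n} = {x ∈ D^p_n | d x ∈ D^{p-r}}`. -/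
def pageCycles (D : GrFlag.{u, v} R d) (r : ℕ) (p : ℤ) (n : ZMod d) : Submodule R D.carrier :=
  D.fil p n ⊓ (D.fil (p - r) (n - 1)).comap D.diff

/-- `D^{p-1}_n + d (D^{p+r-1}_{n+1})`. -/
def pageBoundaries (D : GrFlag.{u, v} R d) (r : ℕ) (p : ℤ) (n : ZMod d) : Submodule R D.carrier :=
  D.fil (p - 1) n ⊔ (D.fil (p + r - 1) (n + 1)).map D.diff

/-- The term `E^r_{p,n} = Z^r_{p,n} / ((D^{p-1}_n + d (D^{p+r-1}_{n+1})) ∩ Z^r_{p,n})`. -/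
abbrev page (D : GrFlag.{u, v} R d) (r : ℕ) (p : ℤ) (n : ZMod d) : Type v :=
  D.pageCycles r p n ⧸ (D.pageBoundaries r p n).submoduleOf (D.pageCycles r p n)

theorem diff_mem_pageCycles (D : GrFlag.{u, v} R d) (r : ℕ) (p : ℤ) (n : ZMod d) :
    ∀ x ∈ D.pageCycles r p n, D.diff x ∈ D.pageCycles r (p - r) (n - 1) := by
  rintro x ⟨_, hx⟩
  refine ⟨hx, ?_⟩
  change D.diff (D.diff x) ∈ D.fil (p - r - r) (n - 1 - 1)
  rw [D.diff_diff]
  exact Submodule.zero_mem _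

theorem diff_mem_pageBoundaries (D : GrFlag.{u, v} R d) (r : ℕ) (p : ℤ) (n : ZMod d) :
    ∀ x ∈ D.pageBoundaries r p n, D.diff x ∈ D.pageBoundaries r (p - r) (n - 1) := by
  intro x hx
  obtain ⟨a, ha, b, ⟨c, _, rfl⟩, rfl⟩ := Submodule.mem_sup.1 hx
  rw [map_add, D.diff_diff, add_zero]
  refine Submodule.mem_sup_right ⟨a, ?_, rfl⟩
  have h1 : p - (r : ℤ) + r - 1 = p - 1 := by ring
  have h2 : n - 1 + 1 = n := by ring
  rw [h1, h2]
  exact ha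

/-- The differential `E^r_{p,n} → E^r_{p-r,n-1}` of the `r`-th page, induced by the differential
of `D`. -/
def pageDiff (D : GrFlag.{u, v} R d) (r : ℕ) (p : ℤ) (n : ZMod d) :
    D.page r p n →ₗ[R] D.page r (p - r) (n - 1) :=
  Submodule.mapQ _ _ (D.diff.restrict (D.diff_mem_pageCycles r p n))
    (fun x hx => D.diff_mem_pageBoundaries r p n x.1 hx)

/-- The spectral sequence degenerates on the page `E^r`: the differentials of `E^r` and of all
later pages vanish. -/
def DegeneratesAt (D : GrFlag.{u, v} R d) (r : ℕ) : Prop :=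
  ∀ (s : ℕ), r ≤ s → ∀ (p : ℤ) (n : ZMod d), D.pageDiff s p n = 0

end GrFlag

/-- A projective flag resolution of a `ℤ/d`-graded differential module `D`: a projective flag
together with a quasi-isomorphism of differential modules to `D`, the augmentation map. -/
structure ProjFlagResolution {R : Type u} [CommRing R] {d : ℕ} (D : GrDiffMod.{u, v} R d) where
  flag : GrFlag.{u, w} R d
  isProjective : flag.IsProjective
  aug : GrDiffMod.Hom flag.toGrDiffMod D
  isQuasiIso : aug.IsQuasiIso

/-! A free resolution arises by attaching cells: one without faces for each cycle of `D`, and,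
whenever a cycle `z` of the flag maps to a boundary `d y` in `D`, one with boundary `z` and value
`y`. The new cell must lie in higher filtration degree than the cells of `z`, with its value in the
matching step of `D`. If `z` has filtration degree at most `p`, degeneration lets `y` be chosen in
filtration degree `p + r - 1` (`DegeneratesAt.exists_mem_fil_diff_eq`), which exceeds `p` because `r
≥ 2`.

Instead of attaching in stages, all admissible cells are taken at once, as an inductive family. A
cycle is a finite combination of valid cells, so it is already the boundary of a valid cell
(`DegeneratesAt.exists_cellDiff_eq`). Validity is a predicate on previously formed raw cells because
the condition `d² = 0` involves the boundaries of the faces. -/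

namespace GrFlag

/-! ### Boundaries under degeneration -/

section Degeneration

variable {R : Type u} [CommRing R] {d : ℕ} {D : GrFlag.{u, v} R d} {r : ℕ}

/-- Vanishing of the class of `d x` on page `s` means `d x = a + d y` with `a` one filtration step
deeper than `d x`; subtracting `y` leaves `a`. -/
theorem DegeneratesAt.exists_sub (hdeg : D.DegeneratesAt r) {s : ℕ} (hs : r ≤ s) {p : ℤ}
    {n : ZMod d} {x : D.carrier} (hx : x ∈ D.fil p n) (hdx : D.diff x ∈ D.fil (p - s) (n - 1)) :
    ∃ y ∈ D.fil (p - 1) n, D.diff (x - y) ∈ D.fil (p - (s + 1 : ℕ)) (n - 1) := by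
  have h := LinearMap.congr_fun (hdeg s hs p n)
    (Submodule.Quotient.mk (⟨x, hx, hdx⟩ : D.pageCycles s p n))
  rw [LinearMap.zero_apply] at h
  have h' : D.diff x ∈ D.pageBoundaries s (p - s) (n - 1) := by
    have := (Submodule.Quotient.mk_eq_zero _).1 h
    exact this
  obtain ⟨a, ha, _, ⟨y, hy, rfl⟩, hay⟩ := Submodule.mem_sup.1 h'
  have e1 : p - (s : ℤ) + s - 1 = p - 1 := by ring
  have e2 : n - 1 + 1 = n := by ring
  have e3 : p - (s : ℤ) - 1 = p - (s + 1 : ℕ) := by push_cast; ring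
  rw [e1, e2] at hy
  rw [e3] at ha
  refine ⟨y, hy, ?_⟩
  rw [map_sub, ← hay, add_sub_cancel_right]
  exact ha

/-- After degeneration, an element whose differential drops the filtration by at least `r` has the
same differential as an element of lower filtration. -/
theorem DegeneratesAt.exists_diff_eq (hdeg : D.DegeneratesAt r) {p : ℤ} {n : ZMod d} (k : ℕ) :
    ∀ (s : ℕ), r ≤ s → p - s < k → ∀ x ∈ D.fil p n, D.diff x ∈ D.fil (p - s) (n - 1) →
      ∃ y ∈ D.fil (p - 1) n, D.diff y = D.diff x := by
  induction k with
  | zero =>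
    intro s _ hk x _ hdx
    -- Now `p - s < 0`: the filtration is zero there, which ends the iteration.
    rw [D.fil_neg _ _ (by simpa using hk), Submodule.mem_bot] at hdx
    exact ⟨0, Submodule.zero_mem _, by rw [hdx, map_zero]⟩
  | succ k ih =>
    intro s hs hk x hx hdx
    obtain ⟨y, hy, hxy⟩ := hdeg.exists_sub hs hx hdx
    obtain ⟨z, hz, hzx⟩ := ih (s + 1) (by omega) (by push_cast at hk ⊢; omega) (x - y)
      (Submodule.sub_mem _ hx (D.fil_mono _ _ _ (by omega) hy)) hxy
    exact ⟨z + y, Submodule.add_mem _ hz hy, by rw [map_add, hzx, map_sub, sub_add_cancel]⟩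

/-- If the spectral sequence degenerates on `E^r`, a boundary in filtration degree `q` is the
boundary of an element of filtration degree `q + r - 1`. -/
theorem DegeneratesAt.exists_mem_fil_diff_eq (hdeg : D.DegeneratesAt r) {q : ℤ} {n : ZMod d}
    {x : D.carrier} (hx : x ∈ D.grade n) (hdx : D.diff x ∈ D.fil q (n - 1)) :
    ∃ y ∈ D.fil (q + r - 1) n, D.diff y = D.diff x := by
  have key : ∀ (k : ℕ) (x : D.carrier), x ∈ D.fil (q + r - 1 + k) n →
      D.diff x ∈ D.fil q (n - 1) → ∃ y ∈ D.fil (q + r - 1) n, D.diff y = D.diff x := by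
    intro k
    induction k with
    | zero => exact fun x hx _ => ⟨x, by simpa using hx, rfl⟩
    | succ k ih =>
      intro x hx hdx
      -- From filtration degree `q + r - 1 + (k + 1)` down to `q` the drop is `r + k ≥ r`, so the
      -- filtration degree of `x` can be lowered by one.
      have e : q + (r : ℤ) - 1 + (k + 1 : ℕ) - (r + k : ℕ) = q := by push_cast; ring
      obtain ⟨y, hy, hyx⟩ := hdeg.exists_diff_eq (q.toNat + 1) (r + k) (by omega)
        (by rw [e]; push_cast; omega) x hx (by rwa [e])
      obtain ⟨z, hz, hzy⟩ := ih y
        (D.fil_mono _ _ _ (by push_cast; omega) hy) (by rwa [hyx])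
      exact ⟨z, hz, hzy.trans hyx⟩
  obtain ⟨i, hi⟩ := D.fil_exhaustive n x hx
  exact key (i - (q + r - 1)).toNat x (D.fil_mono _ _ _ (by omega) hi) hdx

end Degeneration

/-! ### Cells and the free differential module on them -/

/-- A formal cell of filtration degree `lvl` and degree `deg`, with image `val` in `M` and with
boundary `∑ i, coeff i • face i`. -/
inductive Cell (R : Type u) (d : ℕ) (M : Type v) : Type (max u v)
  | mk (lvl : ℤ) (deg : ZMod d) (val : M) (n : ℕ) (coeff : Fin n → R) (face : Fin n → Cell R d M) :
    Cell R d M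

namespace Cell

variable {R : Type u} {d : ℕ} {M : Type v}

def lvl : Cell R d M → ℤ
  | mk p _ _ _ _ _ => p

def deg : Cell R d M → ZMod d
  | mk _ j _ _ _ _ => j

def val : Cell R d M → M
  | mk _ _ y _ _ _ => y

def dim : Cell R d M → ℕ
  | mk _ _ _ n _ _ => n

def coeff : (t : Cell R d M) → Fin t.dim → R
  | mk _ _ _ _ c _ => c

def face : (t : Cell R d M) → Fin t.dim → Cell R d M
  | mk _ _ _ _ _ f => f

/-- The boundary of a cell. -/
noncomputable def bdry [Semiring R] (t : Cell R d M) : Cell R d M →₀ R :=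
  ∑ i, Finsupp.single (t.face i) (t.coeff i)

end Cell

variable {R : Type u} [CommRing R] {d : ℕ} (D : GrFlag.{u, v} R d)

/-- The cells that fit together to a flag over `D`. -/
inductive ValidCell : Cell R d D.carrier → Prop
  | intro (t : Cell R d D.carrier)
    (valid_face : ∀ i, ValidCell (t.face i))
    (lvl_nonneg : 0 ≤ t.lvl)
    (lvl_face : ∀ i, (t.face i).lvl ≤ t.lvl - 1)
    (deg_face : ∀ i, (t.face i).deg = t.deg - 1)
    (bdry_bdry : ∑ i, t.coeff i • (t.face i).bdry = 0)
    (val_bdry : ∑ i, t.coeff i • (t.face i).val = D.diff t.val)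
    (val_mem : t.val ∈ D.fil t.lvl t.deg) : ValidCell t

/-- The valid cells, a basis of the cell flag. -/
abbrev CellBasis : Type (max u v) := {t : Cell R d D.carrier // D.ValidCell t}

namespace CellBasis

variable {D}

theorem lvl_nonneg (t : D.CellBasis) : 0 ≤ t.1.lvl := by
  obtain ⟨_, ⟨_, _, h, _, _, _, _, _⟩⟩ := t; exact h

theorem val_mem (t : D.CellBasis) : t.1.val ∈ D.fil t.1.lvl t.1.deg := by
  obtain ⟨_, ⟨_, _, _, _, _, _, _, h⟩⟩ := t; exact h

theorem lvl_face (t : D.CellBasis) (i) : (t.1.face i).lvl ≤ t.1.lvl - 1 := by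
  obtain ⟨_, ⟨_, _, _, h, _, _, _, _⟩⟩ := t; exact h i

theorem deg_face (t : D.CellBasis) (i) : (t.1.face i).deg = t.1.deg - 1 := by
  obtain ⟨_, ⟨_, _, _, _, h, _, _, _⟩⟩ := t; exact h i

theorem bdry_bdry (t : D.CellBasis) : ∑ i, t.1.coeff i • (t.1.face i).bdry = 0 := by
  obtain ⟨_, ⟨_, _, _, _, _, h, _, _⟩⟩ := t; exact h

theorem val_bdry (t : D.CellBasis) :
    ∑ i, t.1.coeff i • (t.1.face i).val = D.diff t.1.val := by
  obtain ⟨_, ⟨_, _, _, _, _, _, h, _⟩⟩ := t; exact h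

/-- A face of a valid cell. -/
def face (t : D.CellBasis) (i : Fin t.1.dim) : D.CellBasis :=
  ⟨t.1.face i, by obtain ⟨_, ⟨_, h, _, _, _, _, _, _⟩⟩ := t; exact h i⟩

/-- The boundary of a valid cell. -/
noncomputable def bdry (t : D.CellBasis) : D.CellBasis →₀ R :=
  ∑ i, Finsupp.single (t.face i) (t.1.coeff i)

theorem mapDomain_bdry (t : D.CellBasis) :
    Finsupp.lmapDomain R R Subtype.val t.bdry = t.1.bdry := by
  simp [bdry, Cell.bdry, Finsupp.mapDomain_single, face]

end CellBasis

/-- The differential of the cell flag. -/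
noncomputable def cellDiff : (D.CellBasis →₀ R) →ₗ[R] D.CellBasis →₀ R :=
  Finsupp.linearCombination R CellBasis.bdry

/-- The augmentation of the cell flag. -/
noncomputable def cellAug : (D.CellBasis →₀ R) →ₗ[R] D.carrier :=
  Finsupp.linearCombination R fun t => t.1.val

@[simp]
theorem cellDiff_single (t : D.CellBasis) (c : R) :
    D.cellDiff (Finsupp.single t c) = c • t.bdry :=
  Finsupp.linearCombination_single ..

@[simp]
theorem cellAug_single (t : D.CellBasis) (c : R) :
    D.cellAug (Finsupp.single t c) = c • t.1.val :=
  Finsupp.linearCombination_single ..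

/-- Validity imposes `d² = 0` among combinations of raw cells; the inclusion of valid cells is
injective, so the identity descends. -/
theorem cellDiff_bdry (t : D.CellBasis) : D.cellDiff t.bdry = 0 := by
  apply Finsupp.mapDomain_injective (Subtype.val_injective (p := D.ValidCell))
  have h := t.bdry_bdry
  rw [Finsupp.mapDomain_zero, ← Finsupp.lmapDomain_apply R R, ← h]
  conv_lhs => rw [CellBasis.bdry, map_sum, map_sum]
  refine Finset.sum_congr rfl fun i _ => ?_
  rw [cellDiff_single, map_smul, CellBasis.mapDomain_bdry]
  rfl

theorem cellDiff_cellDiff (x : D.CellBasis →₀ R) : D.cellDiff (D.cellDiff x) = 0 := by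
  induction x using Finsupp.induction_linear with
  | zero => simp
  | add x y hx hy => simp [hx, hy]
  | single t c => rw [cellDiff_single, map_smul, cellDiff_bdry, smul_zero]

theorem cellAug_cellDiff (x : D.CellBasis →₀ R) :
    D.cellAug (D.cellDiff x) = D.diff (D.cellAug x) := by
  induction x using Finsupp.induction_linear with
  | zero => simp
  | add x y hx hy => simp [hx, hy]
  | single t c =>
    rw [cellDiff_single, cellAug_single, map_smul, map_smul, ← t.val_bdry, CellBasis.bdry, map_sum]
    simp [CellBasis.face]

/-! ### Grading and filtration by cells -/

/-- The span of the valid cells of degree `j`. -/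
def cellGrade (j : ZMod d) : Submodule R (D.CellBasis →₀ R) :=
  Finsupp.supported R R {t | t.1.deg = j}

/-- The span of the valid cells of degree `j` and filtration degree at most `i`. -/
def cellFil (i : ℤ) (j : ZMod d) : Submodule R (D.CellBasis →₀ R) :=
  Finsupp.supported R R {t | t.1.deg = j ∧ t.1.lvl ≤ i}

theorem _root_.Finsupp.supported_le_iff {ι M : Type*} [AddCommGroup M] [Module R M]
    {s : Set ι} {p : Submodule R (ι →₀ M)} :
    Finsupp.supported M R s ≤ p ↔ ∀ i ∈ s, ∀ c, Finsupp.single i c ∈ p := by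
  refine ⟨fun h i hi c => h (Finsupp.single_mem_supported R c hi), fun h x hx => ?_⟩
  rw [← Finsupp.sum_single x]
  exact Submodule.sum_mem _ fun i hi => h i (hx hi) _

theorem _root_.Finsupp.isInternal_supported_fiber {ι κ M : Type*} [DecidableEq κ] [AddCommGroup M]
    [Module R M] (f : ι → κ) :
    DirectSum.IsInternal fun k => Finsupp.supported M R {i | f i = k} := by
  rw [DirectSum.isInternal_submodule_iff_iSupIndep_and_iSup_eq_top]
  refine ⟨fun k => ?_, ?_⟩
  · have h : ⨆ (l) (_ : l ≠ k), Finsupp.supported M R {i | f i = l} ≤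
        Finsupp.supported M R {i | f i ≠ k} :=
      iSup₂_le fun l hl => Finsupp.supported_mono fun _ hi => ne_of_eq_of_ne hi hl
    refine (Finsupp.disjoint_supported_supported ?_).mono_right h
    exact Set.disjoint_left.2 fun _ hi hi' => hi' hi
  · rw [← Finsupp.supported_iUnion, eq_top_iff, ← Finsupp.supported_univ]
    exact Finsupp.supported_mono fun i _ => Set.mem_iUnion.2 ⟨f i, rfl⟩

/-- The quotient of the functions supported on `s` by those supported on `t`. -/
noncomputable def _root_.Finsupp.supportedQuotientEquiv {ι M : Type*} [AddCommGroup M] [Module R M]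
    (s t : Set ι) :
    (Finsupp.supported M R s ⧸
      (Finsupp.supported M R t).submoduleOf (Finsupp.supported M R s)) ≃ₗ[R]
      ((s \ t : Set ι) →₀ M) := by
  let f : Finsupp.supported M R s →ₗ[R] ((s \ t : Set ι) →₀ M) :=
    Finsupp.lsubtypeDomain (s \ t) ∘ₗ (Finsupp.supported M R s).subtype
  have hf : Function.Surjective f := by
    intro x
    refine ⟨⟨Finsupp.embDomain (Function.Embedding.subtype _) x, ?_⟩, ?_⟩
    · rw [Finsupp.mem_supported, Finsupp.support_embDomain]
      intro i hi
      obtain ⟨⟨i, hi'⟩, _, rfl⟩ := Finset.mem_map.1 hi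
      exact hi'.1
    · ext i
      exact Finsupp.embDomain_apply_self (Function.Embedding.subtype _) x i
  have hk : (Finsupp.supported M R t).submoduleOf (Finsupp.supported M R s) = LinearMap.ker f := by
    ext ⟨x, hx⟩
    rw [LinearMap.mem_ker]
    refine (Finsupp.mem_supported' R x).trans ⟨fun h => ?_, fun h i hi => ?_⟩
    · ext i
      exact h i.1 i.2.2
    · by_cases his : i ∈ s
      · exact DFunLike.congr_fun h (⟨i, his, hi⟩ : (s \ t : Set ι))
      · exact (Finsupp.mem_supported' R x).1 hx i his
  exact (Submodule.quotEquivOfEq _ _ hk).trans (f.quotKerEquivOfSurjective hf)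

theorem bdry_mem_cellFil (t : D.CellBasis) : t.bdry ∈ D.cellFil (t.1.lvl - 1) (t.1.deg - 1) :=
  Submodule.sum_mem _ fun i _ =>
    Finsupp.single_mem_supported R _ ⟨t.deg_face i, t.lvl_face i⟩

theorem cellFil_le_cellGrade (i : ℤ) (j : ZMod d) : D.cellFil i j ≤ D.cellGrade j :=
  Finsupp.supported_mono fun _ h => h.1

theorem cellFil_mono {i i' : ℤ} (j : ZMod d) (h : i ≤ i') : D.cellFil i j ≤ D.cellFil i' j :=
  Finsupp.supported_mono fun _ ht => ⟨ht.1, ht.2.trans h⟩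

theorem exists_mem_cellFil {j : ZMod d} {x : D.CellBasis →₀ R} (hx : x ∈ D.cellGrade j) :
    ∃ i, 0 ≤ i ∧ x ∈ D.cellFil i j :=
  -- Levels are nonnegative, so their sum bounds each of them, and it is also nonnegative when `x =
  -- 0`.
  ⟨∑ t ∈ x.support, t.1.lvl, Finset.sum_nonneg fun t _ => t.lvl_nonneg, fun _ ht =>
    ⟨hx ht, Finset.single_le_sum (f := fun t : D.CellBasis => t.1.lvl)
      (fun t _ => t.lvl_nonneg) ht⟩⟩

theorem cellDiff_mem_cellFil {i : ℤ} {j : ZMod d} {x : D.CellBasis →₀ R} (hx : x ∈ D.cellFil i j) :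
    D.cellDiff x ∈ D.cellFil (i - 1) (j - 1) := by
  have h : D.cellFil i j ≤ (D.cellFil (i - 1) (j - 1)).comap D.cellDiff := by
    refine Finsupp.supported_le_iff.2 ?_
    rintro t ⟨rfl, ht⟩ c
    rw [Submodule.mem_comap, cellDiff_single]
    exact Submodule.smul_mem _ _ (D.cellFil_mono _ (by omega) (D.bdry_mem_cellFil t))
  exact h hx

theorem cellAug_mem_fil {i : ℤ} {j : ZMod d} {x : D.CellBasis →₀ R} (hx : x ∈ D.cellFil i j) :
    D.cellAug x ∈ D.fil i j := by
  have h : D.cellFil i j ≤ (D.fil i j).comap D.cellAug := by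
    refine Finsupp.supported_le_iff.2 ?_
    rintro t ⟨rfl, ht⟩ c
    rw [Submodule.mem_comap, cellAug_single]
    exact Submodule.smul_mem _ _ (D.fil_mono _ _ _ ht t.val_mem)
  exact h hx

/-- The flag that is free on the valid cells over `D`. -/
noncomputable def cellFlag : GrFlag.{u, max u v} R d where
  carrier := D.CellBasis →₀ R
  grade := D.cellGrade
  isInternal := Finsupp.isInternal_supported_fiber _
  diff := D.cellDiff
  diff_diff := D.cellDiff_cellDiff
  diff_grade j x hx := by
    obtain ⟨i, _, hi⟩ := D.exists_mem_cellFil hx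
    exact D.cellFil_le_cellGrade _ _ (D.cellDiff_mem_cellFil hi)
  fil := D.cellFil
  fil_le_grade := D.cellFil_le_cellGrade
  fil_mono _ _ j h := D.cellFil_mono j h
  fil_neg i j hi := by
    have : {t : D.CellBasis | t.1.deg = j ∧ t.1.lvl ≤ i} = ∅ :=
      Set.eq_empty_of_forall_notMem fun t ht => absurd t.lvl_nonneg (by have := ht.2; omega)
    rw [cellFil, this, Finsupp.supported_empty]
  fil_exhaustive j x hx := (D.exists_mem_cellFil hx).imp fun _ h => h.2
  diff_fil _ _ _ hx := D.cellDiff_mem_cellFil hx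

/-- The quotient is free on the cells of degree `j` and level exactly `i`. -/
theorem cellFlag_isProjective : D.cellFlag.IsProjective := fun _ _ =>
  Module.Projective.of_equiv (Finsupp.supportedQuotientEquiv (R := R) (M := R) _ _).symm

/-! ### The augmentation is a quasi-isomorphism -/

/-- The augmentation of the cell flag as a morphism of graded differential modules. -/
noncomputable def cellHom : GrDiffMod.Hom D.cellFlag.toGrDiffMod D.toGrDiffMod where
  toLin := D.cellAug
  map_grade j x hx := by
    obtain ⟨i, _, hi⟩ := D.exists_mem_cellFil hx
    exact D.fil_le_grade _ _ (D.cellAug_mem_fil hi)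
  comm := D.cellAug_cellDiff

/-- Every cycle of `D` is the value of a cell without faces. -/
theorem cellHom_homologyMap_surjective (j : ZMod d) :
    Function.Surjective (D.cellHom.homologyMap j) := by
  intro h
  obtain ⟨⟨x, hx, hdx⟩, rfl⟩ := Submodule.Quotient.mk_surjective _ h
  replace hdx : D.diff x = 0 := hdx
  obtain ⟨i, hi⟩ := D.fil_exhaustive j x hx
  -- The index `i` from exhaustiveness may be negative (when `x = 0`), but levels may not.
  let t : D.CellBasis := ⟨.mk (max i 0) j x 0 Fin.elim0 Fin.elim0, .intro _ (fun i => i.elim0)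
    (le_max_right i 0) (fun i => i.elim0) (fun i => i.elim0) rfl hdx.symm
    (D.fil_mono _ _ _ (le_max_left i 0) hi)⟩
  have ht : D.cellDiff (Finsupp.single t 1) = 0 := by
    rw [cellDiff_single, one_smul]
    rfl
  refine ⟨Submodule.Quotient.mk ⟨Finsupp.single t (1 : R),
    Finsupp.single_mem_supported R _ rfl, ht⟩, ?_⟩
  refine congrArg Submodule.Quotient.mk (Subtype.ext ?_)
  exact (D.cellAug_single t 1).trans (one_smul _ _)

variable {D}

/-- A cycle of the cell flag that becomes a boundary in `D` is a boundary. -/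
theorem DegeneratesAt.exists_cellDiff_eq {r : ℕ} (hr : 2 ≤ r) (hdeg : D.DegeneratesAt r)
    {j : ZMod d} {z : D.CellBasis →₀ R} (hz : z ∈ D.cellGrade j) (hdz : D.cellDiff z = 0)
    {y : D.carrier} (hy : y ∈ D.grade (j + 1)) (hyz : D.diff y = D.cellAug z) :
    ∃ w ∈ D.cellGrade (j + 1), D.cellDiff w = z := by
  obtain ⟨p, hp, hzp⟩ := D.exists_mem_cellFil hz
  obtain ⟨y', hy', hyy⟩ := hdeg.exists_mem_fil_diff_eq (q := p) hy
    (by rw [hyz, add_sub_cancel_right]; exact D.cellAug_mem_fil hzp)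
  let e := z.support.equivFin
  -- Stated twice, since the free module and `D.carrier` live in different universes.
  have hsum : ∀ {N : Type (max u v)} [AddCommMonoid N] (g : D.CellBasis → N),
      ∑ i, g (e.symm i).1 = ∑ t ∈ z.support, g t := fun g => by
    rw [← Finset.sum_coe_sort z.support, ← e.symm.sum_comp]
  have hsum' : ∀ (g : D.CellBasis → D.carrier),
      ∑ i, g (e.symm i).1 = ∑ t ∈ z.support, g t := fun g => by
    rw [← Finset.sum_coe_sort z.support, ← e.symm.sum_comp]
  -- The cell that kills `z`: its faces are the support of `z`, of level at most `p ≤ (p + r - 1) -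
  -- 1`.
  let t : D.CellBasis := ⟨.mk (p + r - 1) (j + 1) y' _ (fun i => z (e.symm i).1)
    (fun i => (e.symm i).1.1), by
      refine .intro _ (fun i => (e.symm i).1.2) ?_ (fun i => ?_) (fun i => ?_) ?_ ?_ hy'
      · change 0 ≤ p + (r : ℤ) - 1
        omega
      · have := (hzp (e.symm i).2).2
        change (e.symm i).1.1.lvl ≤ p + (r : ℤ) - 1 - 1
        omega
      · change (e.symm i).1.1.deg = j + 1 - 1
        rw [add_sub_cancel_right]
        exact (hzp (e.symm i).2).1
      · change ∑ i, z (e.symm i).1 • (e.symm i).1.1.bdry = 0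
        rw [hsum fun t => z t • t.1.bdry]
        -- The condition `d² = 0` for the new cell is the image of `D.cellDiff z = 0` among raw
        -- cells.
        have h := congrArg (Finsupp.lmapDomain R R Subtype.val) hdz
        rw [map_zero, cellDiff, Finsupp.linearCombination_apply, Finsupp.sum, map_sum] at h
        rw [← h]
        exact Finset.sum_congr rfl fun t _ => by rw [map_smul, CellBasis.mapDomain_bdry]
      · change ∑ i, z (e.symm i).1 • (e.symm i).1.1.val = D.diff y'
        rw [hsum' fun t => z t • t.1.val, hyy, hyz]
        rfl⟩
  refine ⟨Finsupp.single t 1, Finsupp.single_mem_supported R _ rfl, ?_⟩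
  rw [cellDiff_single, one_smul]
  change ∑ i, Finsupp.single (e.symm i).1 (z (e.symm i).1) = z
  rw [hsum fun t => Finsupp.single t (z t)]
  exact Finsupp.sum_single z

theorem DegeneratesAt.cellHom_isQuasiIso {r : ℕ} (hr : 2 ≤ r) (hdeg : D.DegeneratesAt r) :
    D.cellHom.IsQuasiIso := by
  refine fun j => ⟨?_, D.cellHom_homologyMap_surjective j⟩
  rw [← LinearMap.ker_eq_bot, LinearMap.ker_eq_bot']
  intro h hh
  obtain ⟨⟨z, hz, hdz⟩, rfl⟩ := Submodule.Quotient.mk_surjective _ h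
  obtain ⟨y, hy, hyz⟩ := (Submodule.Quotient.mk_eq_zero _).1 hh
  obtain ⟨w, hw, hwz⟩ := hdeg.exists_cellDiff_eq hr hz hdz hy hyz
  exact (Submodule.Quotient.mk_eq_zero _).2 ⟨w, hw, hwz⟩

end GrFlag

theorem mainTheorem10 {R : Type u} [CommRing R] [IsNoetherianRing R] (d : ℕ)
    (D : GrFlag.{u, v} R d)
    (hfin : ∀ j : ZMod d, Module.Finite R (D.toGrDiffMod.homology j))
    (r : ℕ) (hr : 2 ≤ r) (hdeg : D.DegeneratesAt r) :
    ∃ P : ProjFlagResolution.{u, v, max u v} D.toGrDiffMod,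
      GrFlag.IsFlagPreserving (F := P.flag) (D := D) P.aug :=
  ⟨⟨D.cellFlag, D.cellFlag_isProjective, D.cellHom, hdeg.cellHom_isQuasiIso hr⟩,
    fun _ _ _ hx => D.cellAug_mem_fil hx⟩
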